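/- Let $\Omega$ be a non-empty set, let $k:\Omega\times\Omega\to\mathbb C$, $k_w(z)=k(z,w)$, be positive definite (a reproducing kernel), let $z_0\in\Omega$, and let $\mathcal E$ be a separable complex Hilbert space. For a Hilbert space $\mathcal D$ let $\mathcal H_k(\mathcal D)$ be the Hilbert space of $\mathcal D$-valued functions on $\Omega$ with reproducing kernel $k_w(z)I_{\mathcal D}$, and let $\mathcal H_k=\mathcal H_k(\mathbb C)$. Let $\mathrm{Mult}(\mathcal H_k)$ be the set of functions $\varphi:\Omega\to\mathbb C$ for which $f\mapsto\varphi f$ is a bounded operator on $\mathcal H_k$ (each such $\varphi$ then also multiplies $\mathcal H_k(\mathcal E)$ boundedly into itself), and let $\mathrm{Mult}(\mathcal H_k(l^2),\mathcal H_k)$ be the set of functions $u:\Omega\to\mathcal B(l^2,\mathbb C)$ for which $(M_uF)(z)=u(z)F(z)$ is a bounded operator $M_u:\mathcal H_k(l^2)\to\mathcal H_k$. Set $$\alpha_k(z)=\sup\{u(z)u(z)^*:\ u\in\mathrm{Mult}(\mathcal H_k(l^2),\mathcal H_k),\ u(z_0)=0,\ \|M_u\|\le 1\},\qquad z\in\Omega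 .$$ Suppose that $F\in\mathcal H_k(\mathcal E)$ is extremal, i.e. $\langle\varphi F,F\rangle_{\mathcal H_k(\mathcal E)}=\varphi(z_0)$ for all $\varphi\in\mathrm{Mult}(\mathcal H_k)$. Then for every $z\in\Omega$ $$\|F(z)\|_{\mathcal E}^2\le(1-\alpha_k(z))\,k_z(z).$$ Here $\alpha_k(z)$ is finite whenever $k_z(z)\neq0$; if $k_z(z)=0$, the right-hand side is read as $0$. -/

import Mathlib

open scoped ComplexOrder InnerProductSpace

noncomputable section

namespace KernelSpace

variable {Ω : Type*}

/-- The operator-valued kernel `(z, w) ↦ k_w(z) I_E`; the scalar kernel is written as a matrix with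
entries `k z w = k_w(z)`. -/
def opKernel (k : Matrix Ω Ω ℂ) (E : Type*) [NormedAddCommGroup E] [InnerProductSpace ℂ E] :
    Matrix Ω Ω (E →L[ℂ] E) :=
  Matrix.of fun z w => k z w • ContinuousLinearMap.id ℂ E

section positivity

variable {E : Type*} [NormedAddCommGroup E] [InnerProductSpace ℂ E]

theorem sum_kernel_mul_inner_nonneg {L : Matrix Ω Ω ℂ} (hL : L.PosSemidef) {ι : Type*}
    (s : Finset ι) (p : ι → Ω) (v : ι → E) :
    0 ≤ ∑ i ∈ s, ∑ j ∈ s, L (p i) (p j) * ⟪v i, v j⟫_ℂ := by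
  have h := (hL.submatrix (fun i : s => p i)).hadamard
    (Matrix.posSemidef_gram ℂ (fun i : s => v i))
  have h1 := h.dotProduct_mulVec_nonneg (fun _ => (1 : ℂ))
  simp only [dotProduct, Matrix.mulVec, Pi.star_apply, star_one, one_mul, mul_one,
    Matrix.hadamard_apply, Matrix.submatrix_apply, Matrix.gram_apply] at h1
  rw [← Finset.sum_coe_sort s]
  refine h1.trans_eq (Finset.sum_congr rfl fun i _ => ?_)
  rw [← Finset.sum_coe_sort s]

theorem posSemidef_opKernel [CompleteSpace E] {k : Matrix Ω Ω ℂ} (hk : k.PosSemidef) :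
    (opKernel k E).PosSemidef := by
  have hherm : ∀ z w, (starRingEnd ℂ) (k w z) = k z w := fun z w => hk.isHermitian.apply z w
  refine ((RKHS.posSemidef_tfae (K := opKernel k E)).out 0 2).mpr ?_
  refine ⟨?_, fun vv => ?_⟩
  · ext z w x
    refine ext_inner_right ℂ fun y => ?_
    simp only [Matrix.conjTranspose_apply, ContinuousLinearMap.star_eq_adjoint,
      ContinuousLinearMap.adjoint_inner_left, opKernel, Matrix.of_apply,
      smul_apply, ContinuousLinearMap.id_apply, inner_smul_left,
      inner_smul_right]
    rw [← hherm z w, Complex.conj_conj]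
  · have h := sum_kernel_mul_inner_nonneg hk vv.support id vv
    have h2 := (Complex.le_def.1 h).1
    simp only [Finsupp.sum, opKernel, Matrix.of_apply, smul_apply,
      ContinuousLinearMap.id_apply, inner_smul_left, hherm]
    simpa using h2

end positivity

instance fact_posSemidef_opKernel (k : Matrix Ω Ω ℂ) [hk : Fact k.PosSemidef] (E : Type*)
    [NormedAddCommGroup E] [InnerProductSpace ℂ E] [CompleteSpace E] :
    Fact (opKernel k E).PosSemidef :=
  ⟨posSemidef_opKernel hk.out⟩

/-- The Hilbert space `H_k(E)` of `E`-valued functions on `Ω`: the one whose reproducing kernel is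
`k_w(z) I_E`. The scalar space `H_k` is `Hk k ℂ`. -/
abbrev Hk (k : Matrix Ω Ω ℂ) [Fact k.PosSemidef] (E : Type*)
    [NormedAddCommGroup E] [InnerProductSpace ℂ E] [CompleteSpace E] : Type _ :=
  RKHS.OfKernel (opKernel k E)

/-- `ℓ²(ℕ)` with complex scalars. -/
abbrev ell2 : Type := lp (fun _ : ℕ => ℂ) 2

section multipliers

variable (k : Matrix Ω Ω ℂ) [Fact k.PosSemidef]
variable {D C : Type*} [NormedAddCommGroup D] [InnerProductSpace ℂ D] [CompleteSpace D]
  [NormedAddCommGroup C] [InnerProductSpace ℂ C] [CompleteSpace C]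

/-- `M` is the bounded multiplication operator `M_Φ : H_k(D) → H_k(C)`. -/
def IsMulOp (Φ : Ω → D →L[ℂ] C) (M : Hk k D →L[ℂ] Hk k C) : Prop :=
  ∀ (F : Hk k D) (z : Ω), M F z = Φ z (F z)

/-- `Mult(H_k(D), H_k(C))`: the `Φ` for which `F ↦ Φ F` is a bounded operator `H_k(D) → H_k(C)`. -/
def Mult (D C : Type*) [NormedAddCommGroup D] [InnerProductSpace ℂ D] [CompleteSpace D]
    [NormedAddCommGroup C] [InnerProductSpace ℂ C] [CompleteSpace C] : Set (Ω → D →L[ℂ] C) :=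
  {Φ | ∃ M : Hk k D →L[ℂ] Hk k C, IsMulOp k Φ M}

theorem IsMulOp.unique {Φ : Ω → D →L[ℂ] C} {M N : Hk k D →L[ℂ] Hk k C}
    (hM : IsMulOp k Φ M) (hN : IsMulOp k Φ N) : M = N := by
  refine ContinuousLinearMap.ext fun F => RKHS.ext fun z => ?_
  rw [hM F z, hN F z]

/-- The function `z ↦ φ(z) I_E` attached to a scalar function `φ`. -/
def scalarFun (φ : Ω → ℂ) (E : Type*) [NormedAddCommGroup E] [InnerProductSpace ℂ E] :
    Ω → E →L[ℂ] E :=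
  fun z => φ z • ContinuousLinearMap.id ℂ E

/-- `Mult(H_k)`, as a set of scalar functions. -/
def ScalarMult : Set (Ω → ℂ) := {φ | scalarFun φ ℂ ∈ Mult k ℂ ℂ}

end multipliers

section abstractRKHS

variable {V H : Type*} [NormedAddCommGroup V] [InnerProductSpace ℂ V] [CompleteSpace V]
  [NormedAddCommGroup H] [InnerProductSpace ℂ H] [CompleteSpace H] [RKHS ℂ H Ω V]

theorem inner_sum_kerFun {k : Matrix Ω Ω ℂ}
    (hker : ∀ (w z : Ω) (x y : V),
      ⟪RKHS.kerFun H w x, RKHS.kerFun H z y⟫_ℂ = k w z * ⟪x, y⟫_ℂ)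
    {ι : Type*} (s : Finset ι) (p : ι → Ω) (v : ι → V) (c : ι → ℂ) :
    ((‖∑ i ∈ s, c i • RKHS.kerFun H (p i) (v i)‖ ^ 2 : ℝ) : ℂ) =
      ∑ i ∈ s, ∑ j ∈ s, (starRingEnd ℂ) (c i) * c j * (k (p i) (p j) * ⟪v i, v j⟫_ℂ) := by
  rw [Complex.ofReal_pow, ← Complex.coe_algebraMap, ← inner_self_eq_norm_sq_to_K]
  rw [sum_inner]
  refine Finset.sum_congr rfl fun i _ => ?_
  rw [inner_sum]
  refine Finset.sum_congr rfl fun j _ => ?_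
  rw [inner_smul_left, inner_smul_right, hker]
  ring

theorem posSemidef_of_mul {k : Matrix Ω Ω ℂ} (hk : k.PosSemidef)
    (hker : ∀ (w z : Ω) (x y : V),
      ⟪RKHS.kerFun H w x, RKHS.kerFun H z y⟫_ℂ = k w z * ⟪x, y⟫_ℂ)
    (e : V) (he : ‖e‖ = 1) (φ : Ω → ℂ) (M : H →L[ℂ] H) (hM : ∀ f z, M f z = φ z • f z) :
    (Matrix.of fun z w =>
      ((‖M‖ ^ 2 : ℝ) - φ z * (starRingEnd ℂ) (φ w)) * k z w : Matrix Ω Ω ℂ).PosSemidef := by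
  have hherm : ∀ z w, (starRingEnd ℂ) (k w z) = k z w := fun z w => hk.isHermitian.apply z w
  have hadj : ∀ w : Ω, ContinuousLinearMap.adjoint M (RKHS.kerFun H w e) =
      (starRingEnd ℂ) (φ w) • RKHS.kerFun H w e := fun w => by
    refine ext_inner_right ℂ fun f => ?_
    rw [ContinuousLinearMap.adjoint_inner_left, RKHS.kerFun_inner, inner_smul_left,
      RKHS.kerFun_inner, hM, Complex.conj_conj, inner_smul_right]
  refine ⟨?_, fun x => ?_⟩
  · ext z w
    simp only [Matrix.conjTranspose_apply, Matrix.of_apply, RCLike.star_def, map_mul,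
      map_sub, Complex.conj_ofReal, Complex.conj_conj, hherm]
    ring
  · have h1 : ‖ContinuousLinearMap.adjoint M (∑ i ∈ x.support, x i • RKHS.kerFun H i e)‖ ^ 2 ≤
        ‖M‖ ^ 2 * ‖∑ i ∈ x.support, x i • RKHS.kerFun H i e‖ ^ 2 := by
      rw [← mul_pow]
      refine pow_le_pow_left₀ (norm_nonneg _) ?_ 2
      refine (ContinuousLinearMap.le_opNorm _ _).trans_eq ?_
      rw [LinearIsometryEquiv.norm_map]
    have hMf : ContinuousLinearMap.adjoint M (∑ i ∈ x.support, x i • RKHS.kerFun H i e) =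
        ∑ i ∈ x.support, (x i * (starRingEnd ℂ) (φ i)) • RKHS.kerFun H i e := by
      rw [map_sum]
      refine Finset.sum_congr rfl fun i _ => ?_
      rw [map_smul, hadj, smul_smul]
    rw [hMf, ← sub_nonneg, ← Complex.zero_le_real, Complex.ofReal_sub, Complex.ofReal_mul,
      inner_sum_kerFun hker x.support (fun i => i) (fun _ => e),
      inner_sum_kerFun hker x.support (fun i => i) (fun _ => e)] at h1
    refine h1.trans_eq ?_
    rw [Finset.mul_sum, ← Finset.sum_sub_distrib]
    refine Finset.sum_congr rfl fun i _ => ?_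
    rw [Finset.mul_sum, ← Finset.sum_sub_distrib]
    refine Finset.sum_congr rfl fun j _ => ?_
    have hee : ⟪e, e⟫_ℂ = 1 := by rw [inner_self_eq_norm_sq_to_K, he]; simp
    simp only [Matrix.of_apply, RCLike.star_def, map_mul, Complex.conj_conj, hee]
    ring

theorem exists_mul_of_posSemidef {k : Matrix Ω Ω ℂ}
    (hker : ∀ (w z : Ω) (x y : V),
      ⟪RKHS.kerFun H w x, RKHS.kerFun H z y⟫_ℂ = k w z * ⟪x, y⟫_ℂ)
    (φ : Ω → ℂ) (c : ℝ) (hc : 0 ≤ c)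
    (hL : (Matrix.of fun z w =>
      ((c ^ 2 : ℝ) - φ z * (starRingEnd ℂ) (φ w)) * k z w : Matrix Ω Ω ℂ).PosSemidef) :
    ∃ M : H →L[ℂ] H, ∀ f z, M f z = φ z • f z := by
  let A : (Ω × V →₀ ℂ) →ₗ[ℂ] H :=
    Finsupp.linearCombination ℂ fun p : Ω × V => RKHS.kerFun H p.1 p.2
  let B : (Ω × V →₀ ℂ) →ₗ[ℂ] H := Finsupp.linearCombination ℂ fun p : Ω × V =>
    (starRingEnd ℂ) (φ p.1) • RKHS.kerFun H p.1 p.2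
  have hdense : DenseRange A := by
    have h := RKHS.kerFun_dense H
    have hr : Set.range A =
        (Submodule.span ℂ {RKHS.kerFun H x v | (x) (v)} : Set H) := by
      rw [← LinearMap.coe_range, Finsupp.range_linearCombination]
      congr 2
      refine Set.ext fun g => ?_
      simp
    rw [DenseRange, hr]
    exact Submodule.dense_iff_topologicalClosure_eq_top.2 h
  have hbound : ∀ f, ‖B f‖ ≤ c * ‖A f‖ := fun f => by
    have h := sum_kernel_mul_inner_nonneg hL f.support (fun p => p.1) (fun p => f p • p.2)
    have eA : A f = ∑ p ∈ f.support, f p • RKHS.kerFun H p.1 p.2 := rfl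
    have eB : B f = ∑ p ∈ f.support,
        (f p * (starRingEnd ℂ) (φ p.1)) • RKHS.kerFun H p.1 p.2 := by
      simp only [B, Finsupp.linearCombination_apply, Finsupp.sum, smul_smul]
    have h2 : ‖B f‖ ^ 2 ≤ c ^ 2 * ‖A f‖ ^ 2 := by
      rw [eA, eB, ← sub_nonneg, ← Complex.zero_le_real, Complex.ofReal_sub, Complex.ofReal_mul,
        inner_sum_kerFun hker, inner_sum_kerFun hker]
      refine h.trans_eq ?_
      rw [Finset.mul_sum, ← Finset.sum_sub_distrib]
      refine Finset.sum_congr rfl fun i _ => ?_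
      rw [Finset.mul_sum, ← Finset.sum_sub_distrib]
      refine Finset.sum_congr rfl fun j _ => ?_
      simp only [Matrix.of_apply, inner_smul_left, inner_smul_right, map_mul, Complex.conj_conj]
      ring
    rw [← mul_pow] at h2
    exact le_of_sq_le_sq h2 (by positivity)
  have hT : ∀ z x, B.extendOfNorm A (RKHS.kerFun H z x) =
      (starRingEnd ℂ) (φ z) • RKHS.kerFun H z x := fun z x => by
    have h := LinearMap.extendOfNorm_eq hdense ⟨_, hbound⟩ (Finsupp.single (z, x) 1)
    simpa [A, B] using h
  refine ⟨ContinuousLinearMap.adjoint (B.extendOfNorm A), fun F z =>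
    ext_inner_left ℂ fun x => ?_⟩
  rw [← RKHS.kerFun_inner, ContinuousLinearMap.adjoint_inner_right, hT, inner_smul_left,
    RKHS.kerFun_inner, Complex.conj_conj, inner_smul_right]

end abstractRKHS

section scalar

variable (k : Matrix Ω Ω ℂ) [Fact k.PosSemidef]
variable (E : Type*) [NormedAddCommGroup E] [InnerProductSpace ℂ E] [CompleteSpace E]

theorem inner_kerFun_kerFun (w z : Ω) (x y : E) :
    ⟪RKHS.kerFun (Hk k E) w x, RKHS.kerFun (Hk k E) z y⟫_ℂ = k w z * ⟪x, y⟫_ℂ := by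
  rw [RKHS.kerFun_inner, RKHS.kerFun_apply, RKHS.OfKernel.kernel_ofKernel]
  simp [opKernel, inner_smul_right]

/-- Every `φ ∈ Mult(H_k)` defines a bounded multiplication operator on `H_k(E)`. -/
theorem exists_isMulOp_scalarFun {φ : Ω → ℂ} (hφ : φ ∈ ScalarMult k) :
    ∃ M : Hk k E →L[ℂ] Hk k E, IsMulOp k (scalarFun φ E) M := by
  obtain ⟨M, hM⟩ := hφ
  exact exists_mul_of_posSemidef (inner_kerFun_kerFun k E) φ ‖M‖ (norm_nonneg M)
    (posSemidef_of_mul Fact.out (inner_kerFun_kerFun k ℂ) 1 norm_one φ M hM)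

end scalar

section extremal

variable (k : Matrix Ω Ω ℂ) [Fact k.PosSemidef] (z₀ : Ω)

/-- `F ∈ H_k(E)` is extremal: `⟨φ F, F⟩ = φ(z₀)` for all `φ ∈ Mult(H_k)`. The operator `M` of
multiplication by `φ` on `H_k(E)` exists (`exists_isMulOp_scalarFun`) and is unique
(`IsMulOp.unique`). The form `⟨x, y⟩`
linear in the first variable is `inner ℂ y x`, as Mathlib's is linear in the second. -/
def IsExtremal {E : Type*} [NormedAddCommGroup E] [InnerProductSpace ℂ E] [CompleteSpace E]
    (F : Hk k E) : Prop :=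
  ∀ φ ∈ ScalarMult k, ∀ M : Hk k E →L[ℂ] Hk k E, IsMulOp k (scalarFun φ E) M →
    ⟪F, M F⟫_ℂ = φ z₀

/-- The `u ∈ Mult(H_k(ℓ²), H_k)` with `‖M_u‖ ≤ 1` and `u(z₀) = 0`. -/
def rowContractions : Set (Ω → ell2 →L[ℂ] ℂ) :=
  {u | u z₀ = 0 ∧ ∃ M : Hk k ell2 →L[ℂ] Hk k ℂ, IsMulOp k u M ∧ ‖M‖ ≤ 1}

/-- The number `u u*`, the operator `u u* : ℂ → ℂ` being multiplication by it. -/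
def rowSq (u : ell2 →L[ℂ] ℂ) : ℝ := (u (ContinuousLinearMap.adjoint u 1)).re

/-- The values `u(z) u*(z)` over the contractive row multipliers `u` vanishing at `z₀`. -/
def alphaSet (z : Ω) : Set ℝ := (fun u => rowSq (u z)) '' rowContractions k z₀

/-- `α_k(z) = sup {u(z) u*(z)}`. The set is non-empty, and bounded above if `k_z(z) ≠ 0`. -/
def alpha (z : Ω) : ℝ := sSup (alphaSet k z₀ z)

end extremal

end KernelSpace

end

open scoped ComplexOrder InnerProductSpace

/-! Fix `z` and a contractive row multiplier `u` with `u(z₀) = 0`. Put `a = u(z)* 1`, `ψ(w) = u(w)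
a` and `s = ‖a‖² = u(z) u(z)*`. Then `ψ` is a scalar multiplier of norm at most `‖a‖`, `ψ(z₀) = 0`
and `ψ(z) = s`.

Let `K` be the closed span of the multiples of `F`, and `h` the projection of `k_z F(z)` onto `K`.
Pairing with `h` evaluates elements of `K` at `z` against `F(z)`, and `ψh` is again in `K`, so `⟨h,
ψh⟩ = s‖h‖²`. Extremality gives `F ⟂ ψh`, and `‖F‖ = 1`, so `|⟨F, h⟩|² ≤ ‖h - ψh‖² ≤ (1 - 2s +
s)‖h‖²`. Since `⟨F, h⟩ = ‖F(z)‖²` and `‖h‖² ≤ k_z(z)‖F(z)‖²`, cancelling `‖F(z)‖²` bounds it by `(1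
- s) k_z(z)`; then take the supremum over `u`.

The multiplier bound is `IsMulOp.posSemidef_apply` with `norm_mul_le_of_posSemidef`; the
orthogonality is `IsExtremal.inner_apply_eq_zero`. -/

namespace KernelSpace

/-! ### Norm bounds for scalar multiplication operators -/

section abstractRKHS

variable {Ω V H : Type*} [NormedAddCommGroup V] [InnerProductSpace ℂ V] [CompleteSpace V]
  [NormedAddCommGroup H] [InnerProductSpace ℂ H] [CompleteSpace H] [RKHS ℂ H Ω V]

/-- Positivity of `(c² - φ φ*) k` bounds the operator of multiplication by `φ` by `c`. -/
theorem norm_mul_le_of_posSemidef {k : Matrix Ω Ω ℂ}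
    (hker : ∀ (w z : Ω) (x y : V),
      ⟪RKHS.kerFun H w x, RKHS.kerFun H z y⟫_ℂ = k w z * ⟪x, y⟫_ℂ)
    (φ : Ω → ℂ) (c : ℝ) (hc : 0 ≤ c)
    (hL : (Matrix.of fun z w =>
      ((c ^ 2 : ℝ) - φ z * (starRingEnd ℂ) (φ w)) * k z w : Matrix Ω Ω ℂ).PosSemidef)
    (M : H →L[ℂ] H) (hM : ∀ f z, M f z = φ z • f z) : ‖M‖ ≤ c := by
  have hadj : ∀ w x, ContinuousLinearMap.adjoint M (RKHS.kerFun H w x) =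
      (starRingEnd ℂ) (φ w) • RKHS.kerFun H w x := fun w x => by
    refine ext_inner_right ℂ fun f => ?_
    rw [ContinuousLinearMap.adjoint_inner_left, RKHS.kerFun_inner, inner_smul_left,
      RKHS.kerFun_inner, hM, Complex.conj_conj, inner_smul_right]
  let A : (Ω × V →₀ ℂ) →ₗ[ℂ] H :=
    Finsupp.linearCombination ℂ fun p : Ω × V => RKHS.kerFun H p.1 p.2
  have hdense : DenseRange A := by
    have hr : Set.range A =
        (Submodule.span ℂ {RKHS.kerFun H x v | (x) (v)} : Set H) := by
      rw [← LinearMap.coe_range, Finsupp.range_linearCombination]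
      congr 2
      refine Set.ext fun g => ?_
      simp
    rw [DenseRange, hr]
    exact Submodule.dense_iff_topologicalClosure_eq_top.2 (RKHS.kerFun_dense H)
  -- The adjoint is explicit on kernel functions, whose span is dense, so the bound is proved for
  -- it.
  rw [← LinearIsometryEquiv.norm_map ContinuousLinearMap.adjoint M]
  refine ContinuousLinearMap.opNorm_le_bound _ hc fun g => ?_
  refine hdense.induction_on (p := fun g => ‖ContinuousLinearMap.adjoint M g‖ ≤ c * ‖g‖) g
    (isClosed_le (by fun_prop) (by fun_prop)) fun f => ?_
  have h := sum_kernel_mul_inner_nonneg hL f.support (fun p => p.1) (fun p => f p • p.2)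
  have eA : A f = ∑ p ∈ f.support, f p • RKHS.kerFun H p.1 p.2 := rfl
  have eB : ContinuousLinearMap.adjoint M (A f) = ∑ p ∈ f.support,
      (f p * (starRingEnd ℂ) (φ p.1)) • RKHS.kerFun H p.1 p.2 := by
    simp only [eA, map_sum, map_smul, hadj, smul_smul]
  have h2 : ‖ContinuousLinearMap.adjoint M (A f)‖ ^ 2 ≤ c ^ 2 * ‖A f‖ ^ 2 := by
    rw [eB, eA, ← sub_nonneg, ← Complex.zero_le_real, Complex.ofReal_sub, Complex.ofReal_mul,
      inner_sum_kerFun hker, inner_sum_kerFun hker]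
    refine h.trans_eq ?_
    rw [Finset.mul_sum, ← Finset.sum_sub_distrib]
    refine Finset.sum_congr rfl fun i _ => ?_
    rw [Finset.mul_sum, ← Finset.sum_sub_distrib]
    refine Finset.sum_congr rfl fun j _ => ?_
    simp only [Matrix.of_apply, inner_smul_left, inner_smul_right, map_mul, Complex.conj_conj]
    ring
  rw [← mul_pow] at h2
  exact le_of_sq_le_sq h2 (by positivity)

end abstractRKHS

variable {Ω : Type*} (k : Matrix Ω Ω ℂ) [Fact k.PosSemidef]
variable {D : Type*} [NormedAddCommGroup D] [InnerProductSpace ℂ D] [CompleteSpace D]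
variable {E : Type*} [NormedAddCommGroup E] [InnerProductSpace ℂ E] [CompleteSpace E]

theorem conj_kernel (z w : Ω) : (starRingEnd ℂ) (k w z) = k z w :=
  (Fact.out : k.PosSemidef).isHermitian.apply z w

/-! ### From row multipliers to scalar multipliers -/

variable {k}

theorem IsMulOp.adjoint_kerFun {u : Ω → D →L[ℂ] ℂ} {M : Hk k D →L[ℂ] Hk k ℂ}
    (hM : IsMulOp k u M) (w : Ω) :
    ContinuousLinearMap.adjoint M (RKHS.kerFun (Hk k ℂ) w 1) =
      RKHS.kerFun (Hk k D) w (ContinuousLinearMap.adjoint (u w) 1) := by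
  refine ext_inner_right ℂ fun f => ?_
  rw [ContinuousLinearMap.adjoint_inner_left, RKHS.kerFun_inner, RKHS.kerFun_inner, hM,
    ContinuousLinearMap.adjoint_inner_left]

/-- The kernel `(1 - u u*) k` of a contractive row multiplier `u` is positive. -/
theorem IsMulOp.posSemidef_one_sub {u : Ω → D →L[ℂ] ℂ} {M : Hk k D →L[ℂ] Hk k ℂ}
    (hM : IsMulOp k u M) (hM1 : ‖M‖ ≤ 1) :
    (Matrix.of fun z w => (1 - ⟪ContinuousLinearMap.adjoint (u z) 1,
      ContinuousLinearMap.adjoint (u w) 1⟫_ℂ) * k z w : Matrix Ω Ω ℂ).PosSemidef := by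
  refine ⟨?_, fun x => ?_⟩
  · ext z w
    simp only [Matrix.conjTranspose_apply, Matrix.of_apply, RCLike.star_def, map_mul,
      map_sub, map_one, inner_conj_symm, conj_kernel]
  · have h1 : ‖ContinuousLinearMap.adjoint M (∑ i ∈ x.support, x i • RKHS.kerFun (Hk k ℂ) i 1)‖ ^ 2
        ≤ ‖∑ i ∈ x.support, x i • RKHS.kerFun (Hk k ℂ) i (1 : ℂ)‖ ^ 2 := by
      refine pow_le_pow_left₀ (norm_nonneg _) ?_ 2
      refine (ContinuousLinearMap.le_opNorm _ _).trans ?_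
      rw [LinearIsometryEquiv.norm_map]
      exact mul_le_of_le_one_left (norm_nonneg _) hM1
    have hMf : ContinuousLinearMap.adjoint M (∑ i ∈ x.support, x i • RKHS.kerFun (Hk k ℂ) i 1) =
        ∑ i ∈ x.support,
          x i • RKHS.kerFun (Hk k D) i (ContinuousLinearMap.adjoint (u i) 1) := by
      simp only [map_sum, map_smul, hM.adjoint_kerFun]
    rw [hMf, ← sub_nonneg, ← Complex.zero_le_real, Complex.ofReal_sub,
      inner_sum_kerFun (inner_kerFun_kerFun k ℂ) x.support (fun i => i) (fun _ => 1),
      inner_sum_kerFun (inner_kerFun_kerFun k D) x.support (fun i => i)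
        (fun i => ContinuousLinearMap.adjoint (u i) 1)] at h1
    refine h1.trans_eq ?_
    rw [← Finset.sum_sub_distrib]
    refine Finset.sum_congr rfl fun i _ => ?_
    rw [← Finset.sum_sub_distrib]
    refine Finset.sum_congr rfl fun j _ => ?_
    have h11 : ⟪(1 : ℂ), 1⟫_ℂ = 1 := by simp
    simp only [Matrix.of_apply, RCLike.star_def, h11]
    ring

theorem inner_self_eq_ofReal {H : Type*} [NormedAddCommGroup H] [InnerProductSpace ℂ H] (x : H) :
    ⟪x, x⟫_ℂ = ((‖x‖ ^ 2 : ℝ) : ℂ) := by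
  rw [inner_self_eq_norm_sq_to_K, Complex.ofReal_pow]
  rfl

/-- A Schur product with a Gram matrix; the coefficients are absorbed into the vectors. -/
theorem posSemidef_mul_inner {D : Type*} [NormedAddCommGroup D] [InnerProductSpace ℂ D]
    {L : Matrix Ω Ω ℂ} (hL : L.PosSemidef) (v : Ω → D) :
    (Matrix.of fun z w => L z w * ⟪v z, v w⟫_ℂ : Matrix Ω Ω ℂ).PosSemidef := by
  refine ⟨?_, fun x => ?_⟩
  · ext z w
    have hz : (starRingEnd ℂ) (L w z) = L z w := hL.isHermitian.apply z w
    simp [hz]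
  · refine (sum_kernel_mul_inner_nonneg hL x.support id (fun i => x i • v i)).trans_eq ?_
    refine Finset.sum_congr rfl fun i _ => Finset.sum_congr rfl fun j _ => ?_
    simp only [Matrix.of_apply, RCLike.star_def, inner_smul_left, inner_smul_right, id]
    ring

/-- For a contractive row multiplier `u` and a vector `a`, the scalar kernel
`(‖a‖² - (u a) (u a)*) k` is positive. -/
theorem IsMulOp.posSemidef_apply {u : Ω → D →L[ℂ] ℂ} {M : Hk k D →L[ℂ] Hk k ℂ}
    (hM : IsMulOp k u M) (hM1 : ‖M‖ ≤ 1) (a : D) :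
    (Matrix.of fun z w => ((‖a‖ ^ 2 : ℝ) - u z a * (starRingEnd ℂ) (u w a)) * k z w :
      Matrix Ω Ω ℂ).PosSemidef := by
  let b : Ω → D := fun w => ContinuousLinearMap.adjoint (u w) 1
  have hb : ∀ w, u w a = ⟪b w, a⟫_ℂ := fun w => by
    simp [b, ContinuousLinearMap.adjoint_inner_left]
  -- The target is `‖a‖²(1 - ⟨b z, b w⟩) k` plus `k` times the Gram matrix of `‖a‖` times the
  -- projections of the `b w` onto the complement of `a`. For `a = 0` the quotient below is `0`,
  -- which is harmless.
  have h1 := (hM.posSemidef_one_sub hM1).smul (sq_nonneg ‖a‖)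
  have h2 := posSemidef_mul_inner (Fact.out : k.PosSemidef)
    (fun w => (‖a‖ : ℂ) • b w - (⟪a, b w⟫_ℂ / ‖a‖) • a)
  convert h1.add h2 using 1
  ext z w
  simp only [Matrix.of_apply, Matrix.add_apply, Matrix.smul_apply, hb, inner_conj_symm, inner_sub_left, inner_sub_right, inner_smul_left,
    inner_smul_right, map_div₀, Complex.conj_ofReal, Complex.real_smul]
  rw [inner_self_eq_norm_sq_to_K]
  rcases eq_or_ne a 0 with rfl | ha
  · simp
  · have ha' : (‖a‖ : ℂ) ≠ 0 := by simpa using ha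
    change _ = _ * ((1 - ⟪b z, b w⟫_ℂ) * k z w) + _
    push_cast [Complex.coe_algebraMap]
    field_simp
    ring

theorem mem_scalarMult_of_posSemidef {φ : Ω → ℂ} {c : ℝ} (hc : 0 ≤ c)
    (hL : (Matrix.of fun z w =>
      ((c ^ 2 : ℝ) - φ z * (starRingEnd ℂ) (φ w)) * k z w : Matrix Ω Ω ℂ).PosSemidef) :
    φ ∈ ScalarMult k :=
  exists_mul_of_posSemidef (inner_kerFun_kerFun k ℂ) φ c hc hL

/-! ### The cyclic subspace and extremality -/

theorem one_mem_scalarMult : (fun _ => 1 : Ω → ℂ) ∈ ScalarMult k :=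
  ⟨ContinuousLinearMap.id ℂ _, fun F z => by simp [scalarFun]⟩

theorem IsMulOp.comp_scalarFun {φ ψ : Ω → ℂ} {M N : Hk k E →L[ℂ] Hk k E}
    (hM : IsMulOp k (scalarFun φ E) M) (hN : IsMulOp k (scalarFun ψ E) N) :
    IsMulOp k (scalarFun (φ * ψ) E) (M.comp N) := fun F z => by
  rw [ContinuousLinearMap.comp_apply, hM, hN]
  simp [scalarFun, smul_smul, mul_comm]

theorem mul_mem_scalarMult {φ ψ : Ω → ℂ} (hφ : φ ∈ ScalarMult k) (hψ : ψ ∈ ScalarMult k) :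
    φ * ψ ∈ ScalarMult k := by
  obtain ⟨M, hM⟩ := hφ
  obtain ⟨N, hN⟩ := hψ
  exact ⟨M.comp N, hM.comp_scalarFun hN⟩

/-- The closed subspace of `H_k(E)` generated by the multiples `φ F`, `φ ∈ Mult(H_k)`. -/
noncomputable def cyclicSubspace (F : Hk k E) : Submodule ℂ (Hk k E) :=
  (Submodule.span ℂ {G | ∃ φ ∈ ScalarMult k, ∃ M : Hk k E →L[ℂ] Hk k E,
    IsMulOp k (scalarFun φ E) M ∧ G = M F}).topologicalClosure

theorem self_mem_cyclicSubspace (F : Hk k E) : F ∈ cyclicSubspace F :=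
  Submodule.le_topologicalClosure _ <| Submodule.subset_span
    ⟨_, one_mem_scalarMult, ContinuousLinearMap.id ℂ _, fun F z => by simp [scalarFun], rfl⟩

theorem cyclicSubspace_le (F : Hk k E) {S : Submodule ℂ (Hk k E)} (hS : IsClosed (S : Set (Hk k E)))
    (h : ∀ φ ∈ ScalarMult k, ∀ M : Hk k E →L[ℂ] Hk k E, IsMulOp k (scalarFun φ E) M → M F ∈ S) :
    cyclicSubspace F ≤ S := by
  refine Submodule.topologicalClosure_minimal _ (Submodule.span_le.2 ?_) hS
  rintro _ ⟨φ, hφ, M, hM, rfl⟩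
  exact h φ hφ M hM

theorem IsMulOp.apply_mem_cyclicSubspace {F : Hk k E} {ψ : Ω → ℂ} (hψ : ψ ∈ ScalarMult k)
    {T : Hk k E →L[ℂ] Hk k E} (hT : IsMulOp k (scalarFun ψ E) T) {h : Hk k E}
    (hh : h ∈ cyclicSubspace F) : T h ∈ cyclicSubspace F := by
  have hc : IsClosed ((cyclicSubspace F).comap T.toLinearMap : Set (Hk k E)) :=
    (Submodule.isClosed_topologicalClosure _).preimage T.continuous
  refine cyclicSubspace_le F hc (fun φ hφ M hM => ?_) hh
  exact Submodule.le_topologicalClosure _ <| Submodule.subset_span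
    ⟨_, mul_mem_scalarMult hψ hφ, T.comp M, hT.comp_scalarFun hM, rfl⟩

/-- On a generator `φF` the pairing is `ψ(z₀) φ(z₀) = 0`; linearity and continuity extend this to
the closed span. -/
theorem IsExtremal.inner_apply_eq_zero {z₀ : Ω} {F : Hk k E} (hF : IsExtremal k z₀ F) {ψ : Ω → ℂ}
    (hψ : ψ ∈ ScalarMult k) (hψ₀ : ψ z₀ = 0) {T : Hk k E →L[ℂ] Hk k E}
    (hT : IsMulOp k (scalarFun ψ E) T) {h : Hk k E} (hh : h ∈ cyclicSubspace F) :
    ⟪F, T h⟫_ℂ = 0 := by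
  have hc : IsClosed (((innerSL ℂ F).comp T).ker : Set (Hk k E)) :=
    ContinuousLinearMap.isClosed_ker _
  refine cyclicSubspace_le F hc (fun φ hφ M hM => ?_) hh
  have h1 := hF _ (mul_mem_scalarMult hψ hφ) _ (hT.comp_scalarFun hM)
  simpa [hψ₀] using h1

theorem IsExtremal.norm_eq_one {z₀ : Ω} {F : Hk k E} (hF : IsExtremal k z₀ F) : ‖F‖ = 1 := by
  have h := hF _ one_mem_scalarMult (ContinuousLinearMap.id ℂ _) fun F z => by simp [scalarFun]
  rw [ContinuousLinearMap.id_apply, inner_self_eq_ofReal, Complex.ofReal_eq_one] at h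
  exact (pow_eq_one_iff_of_nonneg (norm_nonneg _) two_ne_zero).1 h

/-! ### Diagonal values of the kernel and of `u u*` -/

theorem kernel_self_re_nonneg (k : Matrix Ω Ω ℂ) [Fact k.PosSemidef] (z : Ω) : 0 ≤ (k z z).re :=
  (Complex.le_def.1 ((Fact.out : k.PosSemidef).diag_nonneg (i := z))).1

theorem kernel_self_eq_ofReal (k : Matrix Ω Ω ℂ) [Fact k.PosSemidef] (z : Ω) : ((k z z).re : ℂ) = k z z :=
  Complex.conj_eq_iff_re.1 (conj_kernel k z z)

theorem norm_sq_kerFun (z : Ω) (x : E) :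
    ‖RKHS.kerFun (Hk k E) z x‖ ^ 2 = (k z z).re * ‖x‖ ^ 2 := by
  have h := inner_kerFun_kerFun k E z z x x
  rw [inner_self_eq_ofReal, inner_self_eq_ofReal, ← kernel_self_eq_ofReal k] at h
  exact_mod_cast h

theorem rowSq_eq_norm_sq (u : ell2 →L[ℂ] ℂ) :
    rowSq u = ‖ContinuousLinearMap.adjoint u 1‖ ^ 2 := by
  have h : u (ContinuousLinearMap.adjoint u 1) = (‖ContinuousLinearMap.adjoint u 1‖ ^ 2 : ℝ) := by
    have h1 := ContinuousLinearMap.adjoint_inner_left u (ContinuousLinearMap.adjoint u 1) 1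
    rw [inner_self_eq_norm_sq_to_K] at h1
    simpa using h1.symm
  rw [rowSq, h, Complex.ofReal_re]

theorem rowSq_le_one {z₀ z : Ω} (hz : k z z ≠ 0) {u : Ω → ell2 →L[ℂ] ℂ}
    (hu : u ∈ rowContractions k z₀) : rowSq (u z) ≤ 1 := by
  obtain ⟨-, M, hM, hM1⟩ := hu
  have h := (hM.posSemidef_one_sub hM1).diag_nonneg (i := z)
  rw [Matrix.of_apply, inner_self_eq_ofReal, ← kernel_self_eq_ofReal k] at h
  have h1 : 0 ≤ (1 - rowSq (u z)) * (k z z).re := by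
    rw [rowSq_eq_norm_sq]
    exact_mod_cast h
  have hpos : 0 < (k z z).re := (kernel_self_re_nonneg k z).lt_of_ne fun h0 => hz <| by
    rw [← kernel_self_eq_ofReal k, ← h0, Complex.ofReal_zero]
  linarith [nonneg_of_mul_nonneg_left h1 hpos]

theorem zero_mem_rowContractions (z₀ : Ω) : 0 ∈ rowContractions k z₀ := by
  refine ⟨rfl, 0, fun F z => ?_, ?_⟩
  · change (0 : Hk k ℂ) z = 0
    rw [RKHS.coe_zero, Pi.zero_apply]
  · exact (norm_zero (E := Hk k ell2 →L[ℂ] Hk k ℂ)).le.trans zero_le_one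

/-! ### The pointwise estimate -/

/-- The estimate behind the bound for an extremal function: `G = ψ h` with `ψ(z) = s`, `h` the
projection of `k_z e`. -/
theorem norm_inner_sq_le_of_inner_eq_zero {H : Type*} [NormedAddCommGroup H]
    [InnerProductSpace ℂ H] {F h G : H} {s : ℝ} (hF : ‖F‖ = 1) (hFG : ⟪F, G⟫_ℂ = 0)
    (hhG : ⟪h, G⟫_ℂ = s * ‖h‖ ^ 2) (hG : ‖G‖ ^ 2 ≤ s * ‖h‖ ^ 2) :
    ‖⟪F, h⟫_ℂ‖ ^ 2 ≤ (1 - s) * ‖h‖ ^ 2 := by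
  have h1 : ‖⟪F, h⟫_ℂ‖ ≤ ‖h - G‖ := by
    simpa [inner_sub_right, hFG, hF] using norm_inner_le_norm (𝕜 := ℂ) F (h - G)
  have h2 := norm_sub_sq (𝕜 := ℂ) h G
  have h3 : RCLike.re ⟪h, G⟫_ℂ = s * ‖h‖ ^ 2 := by
    rw [hhG]
    exact_mod_cast Complex.ofReal_re _
  rw [h3] at h2
  nlinarith [pow_le_pow_left₀ (norm_nonneg _) h1 2]

theorem IsExtremal.norm_sq_le {z₀ : Ω} {F : Hk k E} (hF : IsExtremal k z₀ F) {z : Ω}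
    (hz : k z z ≠ 0) {u : Ω → ell2 →L[ℂ] ℂ} (hu : u ∈ rowContractions k z₀) :
    ‖F z‖ ^ 2 ≤ (1 - rowSq (u z)) * (k z z).re := by
  have hs1 := rowSq_le_one hz hu
  obtain ⟨hu0, M, hM, hM1⟩ := hu
  set s := rowSq (u z) with hs
  let a := ContinuousLinearMap.adjoint (u z) 1
  have hsa : s = ‖a‖ ^ 2 := rowSq_eq_norm_sq (u z)
  let ψ : Ω → ℂ := fun w => u w a
  have hψz : ψ z = s := by
    have h1 := ContinuousLinearMap.adjoint_inner_left (u z) a 1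
    change ⟪a, a⟫_ℂ = _ at h1
    rw [inner_self_eq_norm_sq_to_K] at h1
    rw [hsa]
    simpa [ψ] using h1.symm
  have hψ₀ : ψ z₀ = 0 := by simp [ψ, hu0]
  have hL := hM.posSemidef_apply hM1 a
  have hψ : ψ ∈ ScalarMult k := mem_scalarMult_of_posSemidef (norm_nonneg a) hL
  obtain ⟨T, hT⟩ := exists_isMulOp_scalarFun k E hψ
  have hTa : ‖T‖ ≤ ‖a‖ :=
    norm_mul_le_of_posSemidef (inner_kerFun_kerFun k E) ψ ‖a‖ (norm_nonneg a) hL T hT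
  let K := cyclicSubspace F
  have : CompleteSpace K := (Submodule.isClosed_topologicalClosure _).completeSpace_coe
  let g := RKHS.kerFun (Hk k E) z (F z)
  -- The projection is needed because `g` itself may lie outside `K`, where extremality says
  -- nothing.
  let h := K.starProjection g
  have hh : h ∈ K := K.starProjection_apply_mem g
  have hproj : ∀ f ∈ K, ⟪h, f⟫_ℂ = ⟪F z, f z⟫_ℂ := fun f hf => by
    rw [← RKHS.kerFun_inner, K.inner_starProjection_left_eq_right,
      K.starProjection_eq_self_iff.2 hf]
  have key := norm_inner_sq_le_of_inner_eq_zero (G := T h) (h := h) (s := s) hF.norm_eq_one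
    (hF.inner_apply_eq_zero hψ hψ₀ hT hh) ?_ ?_
  · have hFh : ‖⟪F, h⟫_ℂ‖ = ‖F z‖ ^ 2 := by
      rw [norm_inner_symm, hproj F (self_mem_cyclicSubspace F), inner_self_eq_norm_sq_to_K]
      simp
    have hhg : ‖h‖ ^ 2 ≤ (k z z).re * ‖F z‖ ^ 2 := by
      rw [← norm_sq_kerFun]
      exact pow_le_pow_left₀ (norm_nonneg _) (K.norm_starProjection_apply_le g) 2
    rw [hFh] at key
    have h0 := sub_nonneg.2 hs1
    have h2 : ‖F z‖ ^ 2 * ‖F z‖ ^ 2 ≤ ((1 - s) * (k z z).re) * ‖F z‖ ^ 2 := by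
      nlinarith [mul_le_mul_of_nonneg_left hhg h0]
    -- Cancelling `‖F z‖²` requires it to be nonzero; otherwise the bound only needs `s ≤ 1`.
    rcases (sq_nonneg ‖F z‖).eq_or_lt with h3 | h3
    · rw [← h3]
      exact mul_nonneg h0 (kernel_self_re_nonneg k z)
    · exact le_of_mul_le_mul_right h2 h3
  · rw [hproj _ (hT.apply_mem_cyclicSubspace hψ hh), hT]
    simp only [scalarFun, smul_apply, ContinuousLinearMap.id_apply, inner_smul_right, hψz]
    rw [← hproj h hh, inner_self_eq_norm_sq_to_K]
    rfl
  · rw [hsa, ← mul_pow]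
    exact pow_le_pow_left₀ (norm_nonneg _) (T.le_of_opNorm_le hTa h) 2

theorem apply_eq_zero_of_kernel_eq_zero (F : Hk k E) {z : Ω} (hz : k z z = 0) : F z = 0 := by
  have h := norm_sq_kerFun (k := k) z (F z)
  rw [hz, Complex.zero_re, zero_mul, sq_eq_zero_iff, norm_eq_zero] at h
  have h1 := RKHS.kerFun_inner (𝕜 := ℂ) (H := Hk k E) z (F z) F
  rw [h, inner_zero_left] at h1
  exact inner_self_eq_zero.1 h1.symm

end KernelSpace

open KernelSpace in
theorem corollary4 {Ω : Type*} (k : Matrix Ω Ω ℂ) [Fact k.PosSemidef] (z₀ : Ω)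
    {E : Type*} [NormedAddCommGroup E] [InnerProductSpace ℂ E] [CompleteSpace E]
    [TopologicalSpace.SeparableSpace E]
    (F : Hk k E) (hF : IsExtremal k z₀ F) (z : Ω) :
    (k z z ≠ 0 → BddAbove (alphaSet k z₀ z)) ∧
      ‖F z‖ ^ 2 ≤ (1 - alpha k z₀ z) * (k z z).re := by
  refine ⟨fun hz => ⟨1, ?_⟩, ?_⟩
  · rintro _ ⟨u, hu, rfl⟩
    exact rowSq_le_one hz hu
  by_cases hz : k z z = 0
  -- Both sides vanish, whatever the value of `alpha`.
  · simp [apply_eq_zero_of_kernel_eq_zero F hz, hz]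
  have hpos : 0 < (k z z).re := (kernel_self_re_nonneg k z).lt_of_ne fun h0 => hz <| by
    rw [← kernel_self_eq_ofReal k, ← h0, Complex.ofReal_zero]
  have h : alpha k z₀ z ≤ 1 - ‖F z‖ ^ 2 / (k z z).re := by
    -- The zero multiplier makes the set non-empty.
    refine csSup_le ⟨_, 0, zero_mem_rowContractions z₀, rfl⟩ ?_
    rintro _ ⟨u, hu, rfl⟩
    have h1 := (div_le_iff₀ hpos).2 (hF.norm_sq_le hz hu)
    linarith
  exact (div_le_iff₀ hpos).1 (by linarith)
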